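/- Let $L$ be the language of first order arithmetic with symbols $0, S, +, \cdot, =$, let $L_\Box$ be $L$ with one additional unary relation symbol $\Box$, and fix a Gödel numbering of the formulas of $L_\Box$. Logic is intuitionistic with primitive connectives $\wedge,\vee,\to,\forall,\exists$; $\bot$ is $0=1$ and $\neg A$ is $A\to\bot$. All axioms are sentences (universal closures are taken), and the generalization rules are expressed by the logical axioms $(\forall n_1,\dots,n_k)(A\to B)\to(\forall n_2,\dots,n_k)(A\to(\forall n_1)B)$ for $n_1$ not free in $A$, and $(\forall n_1,\dots,n_k)(A\to B)\to(\forall n_2,\dots,n_k)((\exists n_1)A\to B)$ for $n_1$ not free in $B$. The only deduction rule is: from $(\forall n_1,\dots,n_k)A$ and $(\forall n_1,\dots,n_k)(A\to B)$ infer $(\forall n_1,\dots,n_k)B$. Peano arithmetic PA is regarded as a system of this kind, with the formulas $A\vee\neg A$, for $A$ in $L$, among its non-logical axioms. Let $S$ be a recursively axiomatized theory in the language $L$ which extends PA. The main axioms of $S_\Box$ are the universal closures of: the non-logical axioms of $S$; all instances, for formulas of $L_\Box$, of the induction scheme and of the logical axiom schemes (including those for equality); and the following axioms for $\Box$, where (1)–(5)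 are single sentences which quantify over the Gödel numbers of sentences $A,B$ of $L_\Box$ (of formulas $A(n)$ of $L_\Box$ with one free variable in (3), (4)), and (6) is a scheme over all formulas $A$ of $L_\Box$: (1) $\Box\ulcorner A\vee B\urcorner\leftrightarrow\Box\ulcorner A\urcorner\vee\Box\ulcorner B\urcorner$; (2) $\Box\ulcorner A\wedge B\urcorner\leftrightarrow\Box\ulcorner A\urcorner\wedge\Box\ulcorner B\urcorner$; (3) $(\exists n)\Box\ulcorner A(\bar n)\urcorner\to\Box\ulcorner(\exists n)A(n)\urcorner$; (4) $\Box\ulcorner(\forall n)A(n)\urcorner\leftrightarrow(\forall n)\Box\ulcorner A(\bar n)\urcorner$; (5) $\Box\ulcorner A\to B\urcorner\to(\Box\ulcorner A\urcorner\to\Box\ulcorner B\urcorner)$; (6) $A(n_1,\dots,n_k)\to\Box\ulcorner A(\bar n_1,\dots,\bar n_k)\urcorner$. The syntactic operations occurring in (1)–(6) are expressed by any fixed formulas of $L$ which define them in the standard model. Let ${\rm Ax}(g)$ be any formula of $L$ which expresses (i.e. defines in the standard model) that $g$ is the Gödel number of a main axiom. The axioms of $S_\Box$ are its main axioms and the jump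 axiom $(\forall g)({\rm Ax}(g)\to\Box(g))$. For a sentence $A$ put $\Box^1\ulcorner A\urcorner=\Box\ulcorner A\urcorner$ and $\Box^{k+1}\ulcorner A\urcorner=\Box\ulcorner\Box^k\ulcorner A\urcorner\urcorner$. **Theorem.** Suppose that $S$ is sound, i.e. that its axioms are true in the standard model $\mathbb N$, and let $A$ be a sentence of first order arithmetic which is false in $\mathbb N$. Then $A$ is not a theorem of $S_\Box$, and for every $k\ge 1$ the sentence $\Box^k\ulcorner A\urcorner$ is not a theorem of $S_\Box$. -/

import Mathlib

namespace Assert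

/-! ### Syntax

Terms and formulas of first order arithmetic enriched by one unary relation symbol `□`.
Bound variables are de Bruijn indices, and `Fm n` is the type of formulas whose free variables are
among `0, …, n - 1`; the quantifiers bind the variable `0` of their body. Negation and `⊥` are
abbreviations: `⊥` is `0 = 1` and `¬ A` is `A → ⊥`. -/

/-- Terms in the signature `0, S, +, ·` with variables among `0, …, n - 1`. -/
inductive Tm (n : ℕ) : Type
  | var : Fin n → Tm n
  | zero : Tm n
  | succ : Tm n → Tm n
  | add : Tm n → Tm n → Tm n
  | mul : Tm n → Tm n → Tm n

/-- Formulas of the language of arithmetic with `□`, with free variables among `0, …, n - 1`. -/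
inductive Fm : ℕ → Type
  | eq {n : ℕ} : Tm n → Tm n → Fm n
  | box {n : ℕ} : Tm n → Fm n
  | and {n : ℕ} : Fm n → Fm n → Fm n
  | or {n : ℕ} : Fm n → Fm n → Fm n
  | imp {n : ℕ} : Fm n → Fm n → Fm n
  | all {n : ℕ} : Fm (n + 1) → Fm n
  | ex {n : ℕ} : Fm (n + 1) → Fm n

/-- Sentences are formulas without free variables. -/
abbrev Sentence : Type := Fm 0

/-- The numeral `S (S (… 0))` of a natural number. -/
def numeral {n : ℕ} : ℕ → Tm n
  | 0 => Tm.zero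
  | k + 1 => Tm.succ (numeral k)

/-- Simultaneous substitution in a term. -/
def Tm.subst {n m : ℕ} (σ : Fin n → Tm m) : Tm n → Tm m
  | .var i => σ i
  | .zero => .zero
  | .succ t => .succ (t.subst σ)
  | .add s t => .add (s.subst σ) (t.subst σ)
  | .mul s t => .mul (s.subst σ) (t.subst σ)

/-- Weakening of a term: a new variable `0` is added, and the others move up by one. -/
def Tm.shift {n : ℕ} (t : Tm n) : Tm (n + 1) := t.subst fun i => .var i.succ

/-- The substitution `σ` below a quantifier. -/
def liftSubst {n m : ℕ} (σ : Fin n → Tm m) : Fin (n + 1) → Tm (m + 1) :=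
  Fin.cons (.var 0) fun i => (σ i).shift

/-- Simultaneous (capture-free) substitution in a formula. -/
def Fm.subst : {n m : ℕ} → (Fin n → Tm m) → Fm n → Fm m
  | _, _, σ, .eq s t => .eq (s.subst σ) (t.subst σ)
  | _, _, σ, .box t => .box (t.subst σ)
  | _, _, σ, .and A B => .and (A.subst σ) (B.subst σ)
  | _, _, σ, .or A B => .or (A.subst σ) (B.subst σ)
  | _, _, σ, .imp A B => .imp (A.subst σ) (B.subst σ)
  | _, _, σ, .all A => .all (A.subst (liftSubst σ))
  | _, _, σ, .ex A => .ex (A.subst (liftSubst σ))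

/-- Weakening of a formula: the new variable `0` does not occur free in `A.shift`. -/
def Fm.shift {n : ℕ} (A : Fm n) : Fm (n + 1) := A.subst fun i => .var i.succ

/-- `A.inst t` is `A(t)`: the variable `0` is replaced by `t`, and the others move down by one. -/
def Fm.inst {n : ℕ} (A : Fm (n + 1)) (t : Tm n) : Fm n := A.subst (Fin.cons t .var)

/-- `A(S x)`, where `x` is the variable `0` of `A(x)`. -/
def Fm.instSucc {n : ℕ} (A : Fm (n + 1)) : Fm (n + 1) :=
  A.subst (Fin.cons (.succ (.var 0)) fun i => .var i.succ)

/-- The canonical falsehood `0 = 1`. -/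
def Fm.bot {n : ℕ} : Fm n := .eq .zero (.succ .zero)

/-- Negation. -/
def Fm.neg {n : ℕ} (A : Fm n) : Fm n := .imp A .bot

/-- The biconditional. -/
def Fm.iff {n : ℕ} (A B : Fm n) : Fm n := .and (.imp A B) (.imp B A)

/-- A block of `k` universal quantifiers. -/
def Fm.alls {m : ℕ} : (k : ℕ) → Fm (m + k) → Fm m
  | 0, A => A
  | k + 1, A => Fm.alls k (.all A)

/-- The universal closure of a formula. -/
def Fm.close : {n : ℕ} → Fm n → Sentence
  | 0, A => A
  | _ + 1, A => Fm.close (.all A)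

/-- The formula does not contain `□`, so it is a formula of first order arithmetic. -/
def Fm.IsArith : {n : ℕ} → Fm n → Prop
  | _, .eq _ _ => True
  | _, .box _ => False
  | _, .and A B => A.IsArith ∧ B.IsArith
  | _, .or A B => A.IsArith ∧ B.IsArith
  | _, .imp A B => A.IsArith ∧ B.IsArith
  | _, .all A => A.IsArith
  | _, .ex A => A.IsArith

/-! ### Gödel numbering -/

/-- Number of a term. -/
def Tm.code {n : ℕ} : Tm n → ℕ
  | .var i => Nat.pair 0 i
  | .zero => Nat.pair 1 0
  | .succ t => Nat.pair 2 t.code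
  | .add s t => Nat.pair 3 (Nat.pair s.code t.code)
  | .mul s t => Nat.pair 4 (Nat.pair s.code t.code)

/-- Number of a formula, with the length of its context left out. -/
def Fm.code : {n : ℕ} → Fm n → ℕ
  | _, .eq s t => Nat.pair 0 (Nat.pair s.code t.code)
  | _, .box t => Nat.pair 1 t.code
  | _, .and A B => Nat.pair 2 (Nat.pair A.code B.code)
  | _, .or A B => Nat.pair 3 (Nat.pair A.code B.code)
  | _, .imp A B => Nat.pair 4 (Nat.pair A.code B.code)
  | _, .all A => Nat.pair 5 A.code
  | _, .ex A => Nat.pair 6 A.code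

/-- The Gödel number of a formula with free variables among `0, …, n - 1`. -/
def Fm.gn {n : ℕ} (A : Fm n) : ℕ := Nat.pair n A.code

/-- `⌜A⌝`, the numeral of the Gödel number of `A`. -/
def Fm.quote {n m : ℕ} (A : Fm n) : Tm m := numeral A.gn

/-- `□^k ⌜A⌝`, that is `□⌜□⌜… A …⌝⌝` with `k` boxes; `□^0 ⌜A⌝` is `A`. -/
def boxPow : ℕ → Sentence → Sentence
  | 0, A => A
  | k + 1, A => .box (boxPow k A).quote

/-! ### The standard model -/

/-- Value of a term in `ℕ`. -/
def Tm.eval {n : ℕ} (e : Fin n → ℕ) : Tm n → ℕ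
  | .var i => e i
  | .zero => 0
  | .succ t => t.eval e + 1
  | .add s t => s.eval e + t.eval e
  | .mul s t => s.eval e * t.eval e

/-- Truth in the standard model `ℕ`. This is used for formulas of first order arithmetic only, so
the value at `□` plays no role. -/
def Fm.Realize : {n : ℕ} → Fm n → (Fin n → ℕ) → Prop
  | _, .eq s t, e => s.eval e = t.eval e
  | _, .box _, _ => False
  | _, .and A B, e => A.Realize e ∧ B.Realize e
  | _, .or A B, e => A.Realize e ∨ B.Realize e
  | _, .imp A B, e => A.Realize e → B.Realize e
  | _, .all A, e => ∀ k : ℕ, A.Realize (Fin.cons k e)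
  | _, .ex A, e => ∃ k : ℕ, A.Realize (Fin.cons k e)

/-- Truth of a sentence of first order arithmetic. -/
def Fm.IsTrue (A : Sentence) : Prop := A.Realize Fin.elim0

/-- The formula `φ` of first order arithmetic expresses the relation `R` on `ℕ`. -/
def Expresses {k : ℕ} (φ : Fm k) (R : (Fin k → ℕ) → Prop) : Prop :=
  φ.IsArith ∧ ∀ v : Fin k → ℕ, φ.Realize v ↔ R v

/-! ### Deduction -/

/-- The logical axiom schemes of intuitionistic first order logic with equality. The two
generalization rules are expressed as implications. The axioms themselves are the universal
closures of these formulas. -/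
inductive LogicalAxiom : {n : ℕ} → Fm n → Prop
  | imp_k {n : ℕ} (A B : Fm n) : LogicalAxiom (.imp A (.imp B A))
  | imp_s {n : ℕ} (A B C : Fm n) : LogicalAxiom
      (.imp (.imp A (.imp B C)) (.imp (.imp A B) (.imp A C)))
  | and_intro {n : ℕ} (A B : Fm n) : LogicalAxiom (.imp A (.imp B (.and A B)))
  | and_left {n : ℕ} (A B : Fm n) : LogicalAxiom (.imp (.and A B) A)
  | and_right {n : ℕ} (A B : Fm n) : LogicalAxiom (.imp (.and A B) B)
  | or_left {n : ℕ} (A B : Fm n) : LogicalAxiom (.imp A (.or A B))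
  | or_right {n : ℕ} (A B : Fm n) : LogicalAxiom (.imp B (.or A B))
  | or_elim {n : ℕ} (A B C : Fm n) : LogicalAxiom
      (.imp (.imp A C) (.imp (.imp B C) (.imp (.or A B) C)))
  | ex_falso {n : ℕ} (A : Fm n) : LogicalAxiom (.imp .bot A)
  | all_inst {n : ℕ} (A : Fm (n + 1)) (t : Tm n) : LogicalAxiom (.imp (.all A) (A.inst t))
  | ex_intro {n : ℕ} (A : Fm (n + 1)) (t : Tm n) : LogicalAxiom (.imp (A.inst t) (.ex A))
  | all_gen {m : ℕ} (k : ℕ) (A : Fm (m + k)) (B : Fm (m + k + 1)) : LogicalAxiom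
      (.imp (Fm.alls (k + 1) (.imp A.shift B)) (Fm.alls k (.imp A (.all B))))
  | ex_gen {m : ℕ} (k : ℕ) (A : Fm (m + k + 1)) (B : Fm (m + k)) : LogicalAxiom
      (.imp (Fm.alls (k + 1) (.imp A B.shift)) (Fm.alls k (.imp (.ex A) B)))
  | eq_refl {n : ℕ} (t : Tm n) : LogicalAxiom (.eq t t)
  | eq_subst {n : ℕ} (A : Fm (n + 1)) (s t : Tm n) : LogicalAxiom
      (.imp (.eq s t) (.imp (A.inst s) (A.inst t)))

/-- Theorems of the system with axioms `Γ`: the only rule is modus ponens below a block of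
universal quantifiers. -/
inductive Theorem (Γ : Set Sentence) : Sentence → Prop
  | ax (A : Sentence) : A ∈ Γ → Theorem Γ A
  | mp {k : ℕ} (A B : Fm k) :
      Theorem Γ A.close → Theorem Γ (Fm.imp A B).close → Theorem Γ B.close

/-- The instance of the induction scheme for `A`. -/
def inductionAxiom {n : ℕ} (A : Fm (n + 1)) : Fm n :=
  .imp (A.inst .zero) (.imp (.all (.imp A A.instSucc)) (.all A))

/-- The non-logical axioms of Peano arithmetic, as an intuitionistic system; they include
excluded middle for the formulas of first order arithmetic. -/
inductive PAAxiom : Sentence → Prop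
  | succ_ne_zero : PAAxiom (Fm.neg (.eq (.succ (.var 0)) .zero) : Fm 1).close
  | succ_inj : PAAxiom
      (.imp (.eq (.succ (.var 0)) (.succ (.var 1))) (.eq (.var 0) (.var 1)) : Fm 2).close
  | add_zero : PAAxiom (.eq (.add (.var 0) .zero) (.var 0) : Fm 1).close
  | add_succ : PAAxiom
      (.eq (.add (.var 0) (.succ (.var 1))) (.succ (.add (.var 0) (.var 1))) : Fm 2).close
  | mul_zero : PAAxiom (.eq (.mul (.var 0) .zero) .zero : Fm 1).close
  | mul_succ : PAAxiom
      (.eq (.mul (.var 0) (.succ (.var 1))) (.add (.mul (.var 0) (.var 1)) (.var 0)) : Fm 2).close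
  | induction {n : ℕ} (A : Fm (n + 1)) : A.IsArith → PAAxiom (inductionAxiom A).close
  | em {n : ℕ} (A : Fm n) : A.IsArith → PAAxiom (Fm.or A A.neg).close

/-- All axioms of the theory in the language of first order arithmetic with the set `S` of
non-logical axioms. -/
def arithAxioms (S : Set Sentence) : Set Sentence :=
  S ∪ {A | A.IsArith ∧ ∃ (n : ℕ) (B : Fm n), LogicalAxiom B ∧ A = B.close}

/-- `S` is the set of non-logical axioms of a recursively axiomatized theory in the language of
first order arithmetic which extends PA. -/
structure IsRecursiveExtensionOfPA (S : Set Sentence) : Prop where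
  arith : ∀ A ∈ S, A.IsArith
  recursive : ComputablePred fun g : ℕ => ∃ A ∈ S, A.gn = g
  extends_PA : ∀ A : Sentence,
    Theorem (arithAxioms {B | PAAxiom B}) A → Theorem (arithAxioms S) A

/-- The theory is sound: its axioms are true in the standard model. -/
def IsSound (S : Set Sentence) : Prop := ∀ A ∈ S, A.IsTrue

/-! ### The system `S_□` -/

/-- A choice of formulas of first order arithmetic which express the syntactic operations that
occur in the axioms for `□`. -/
structure Arithmetization where
  /-- `0`, `1`, `2` are the Gödel numbers of sentences `A`, `B`, `A ∨ B`. -/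
  orF : Fm 3
  /-- `0`, `1`, `2` are the Gödel numbers of sentences `A`, `B`, `A ∧ B`. -/
  andF : Fm 3
  /-- `0`, `1`, `2` are the Gödel numbers of sentences `A`, `B`, `A → B`. -/
  impF : Fm 3
  /-- `0`, `1` are the Gödel numbers of a formula `A(x)` and of the sentence `(∀ x) A(x)`. -/
  allF : Fm 2
  /-- `0`, `1` are the Gödel numbers of a formula `A(x)` and of the sentence `(∃ x) A(x)`. -/
  exF : Fm 2
  /-- `0`, `2` are the Gödel numbers of a formula `A` with a free variable and of the formula got
  from `A` when the numeral of the number `1` replaces its first variable. -/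
  subF : Fm 3
  orF_spec : Expresses orF fun v =>
    ∃ A B : Sentence, v 0 = A.gn ∧ v 1 = B.gn ∧ v 2 = (Fm.or A B).gn
  andF_spec : Expresses andF fun v =>
    ∃ A B : Sentence, v 0 = A.gn ∧ v 1 = B.gn ∧ v 2 = (Fm.and A B).gn
  impF_spec : Expresses impF fun v =>
    ∃ A B : Sentence, v 0 = A.gn ∧ v 1 = B.gn ∧ v 2 = (Fm.imp A B).gn
  allF_spec : Expresses allF fun v => ∃ A : Fm 1, v 0 = A.gn ∧ v 1 = (Fm.all A).gn
  exF_spec : Expresses exF fun v => ∃ A : Fm 1, v 0 = A.gn ∧ v 1 = (Fm.ex A).gn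
  subF_spec : Expresses subF fun v =>
    ∃ (k : ℕ) (A : Fm (k + 1)), v 0 = A.gn ∧ v 2 = (A.inst (numeral (v 1))).gn

/-- If `t` denotes the Gödel number of `A(x_0, …, x_{k-1})`, this formula says
`□⌜A(n̄_0, …, n̄_{k-1})⌝`, where `n_i` is the value of `s i`: the numerals are substituted one
after the other, and `□` holds of the result. -/
def Arithmetization.boxInst (R : Arithmetization) :
    {m : ℕ} → (k : ℕ) → (Fin k → Tm m) → Tm m → Fm m
  | _, 0, _, t => .box t
  | _, k + 1, s, t =>
      .ex (.and (R.subF.subst ![t.shift, (s 0).shift, .var 0])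
        (R.boxInst k (fun i => (s i.succ).shift) (.var 0)))

/-- The axioms for `□`: five single axioms, which quantify over all Gödel numbers of sentences
or of formulas with one free variable, and the capture scheme. -/
inductive BoxAxiom (R : Arithmetization) : Sentence → Prop
  /-- `□⌜A ∨ B⌝ ↔ □⌜A⌝ ∨ □⌜B⌝` -/
  | or : BoxAxiom R (Fm.imp R.orF
      (.iff (.box (.var 2)) (.or (.box (.var 0)) (.box (.var 1))))).close
  /-- `□⌜A ∧ B⌝ ↔ □⌜A⌝ ∧ □⌜B⌝` -/
  | and : BoxAxiom R (Fm.imp R.andF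
      (.iff (.box (.var 2)) (.and (.box (.var 0)) (.box (.var 1))))).close
  /-- `(∃ n) □⌜A(n̄)⌝ → □⌜(∃ n) A(n)⌝` -/
  | ex : BoxAxiom R (Fm.imp R.exF
      (.imp (.ex (R.boxInst 1 ![.var 0] (.var 1))) (.box (.var 1)))).close
  /-- `□⌜(∀ n) A(n)⌝ ↔ (∀ n) □⌜A(n̄)⌝` -/
  | all : BoxAxiom R (Fm.imp R.allF
      (.iff (.box (.var 1)) (.all (R.boxInst 1 ![.var 0] (.var 1))))).close
  /-- `□⌜A → B⌝ → (□⌜A⌝ → □⌜B⌝)` -/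
  | imp : BoxAxiom R (Fm.imp R.impF
      (.imp (.box (.var 2)) (.imp (.box (.var 0)) (.box (.var 1))))).close
  /-- `A(n_1, …, n_k) → □⌜A(n̄_1, …, n̄_k)⌝`, for every formula `A`. -/
  | capture {k : ℕ} (A : Fm k) : BoxAxiom R (Fm.imp A (R.boxInst k .var A.quote)).close

/-- The main axioms of `S_□`. -/
inductive MainAxiom (R : Arithmetization) (S : Set Sentence) : Sentence → Prop
  | theory (A : Sentence) : A ∈ S → MainAxiom R S A
  | induction {n : ℕ} (A : Fm (n + 1)) : MainAxiom R S (inductionAxiom A).close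
  | logical {n : ℕ} (A : Fm n) : LogicalAxiom A → MainAxiom R S A.close
  | box (A : Sentence) : BoxAxiom R A → MainAxiom R S A

/-- The axioms of `S_□`: the main axioms and the jump axiom `(∀ g)(Ax(g) → □(g))`. -/
def boxSystem (R : Arithmetization) (S : Set Sentence) (Ax : Fm 1) : Set Sentence :=
  {A | MainAxiom R S A} ∪ {.all (.imp Ax (.box (.var 0)))}

/-! ### Existence of an arithmetization

What follows proves that the formulas required in `Arithmetization` exist: the syntactic
relations are generated by arithmetical rules, and a set generated by arithmetical rules is
arithmetical because derivations can be coded by the beta function. No definition above depends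
on it. -/

theorem Tm.eval_subst {n m : ℕ} (σ : Fin n → Tm m) (t : Tm n) (e : Fin m → ℕ) :
    (t.subst σ).eval e = t.eval fun i => (σ i).eval e := by
  induction t <;> simp_all [Tm.subst, Tm.eval]

theorem Tm.eval_shift {n : ℕ} (t : Tm n) (k : ℕ) (e : Fin n → ℕ) :
    t.shift.eval (Fin.cons k e : Fin (n + 1) → ℕ) = t.eval e := by
  simp [Tm.shift, Tm.eval_subst, Tm.eval]

theorem eval_liftSubst {n m : ℕ} (σ : Fin n → Tm m) (k : ℕ) (e : Fin m → ℕ) :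
    (fun i => (liftSubst σ i).eval (Fin.cons k e : Fin (m + 1) → ℕ)) =
      Fin.cons k fun i => (σ i).eval e := by
  funext i
  refine Fin.cases ?_ (fun i => ?_) i <;> simp [liftSubst, Tm.eval, Tm.eval_shift]

theorem Fm.realize_subst {n : ℕ} (A : Fm n) : ∀ {m : ℕ} (σ : Fin n → Tm m) (e : Fin m → ℕ),
    (A.subst σ).Realize e ↔ A.Realize fun i => (σ i).eval e := by
  induction A <;> intros <;>
    simp_all [Fm.subst, Fm.Realize, Tm.eval_subst, eval_liftSubst]

theorem Fm.isArith_subst {n : ℕ} (A : Fm n) : ∀ {m : ℕ} (σ : Fin n → Tm m),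
    (A.subst σ).IsArith ↔ A.IsArith := by
  induction A <;> intros <;> simp_all [Fm.subst, Fm.IsArith]

/-- The relation is expressed by some formula of first order arithmetic. -/
def Arithmetical {k : ℕ} (R : (Fin k → ℕ) → Prop) : Prop := ∃ φ : Fm k, Expresses φ R

namespace Arithmetical

variable {k : ℕ}

theorem congr {P Q : (Fin k → ℕ) → Prop} (hP : Arithmetical P) (h : ∀ v, P v ↔ Q v) :
    Arithmetical Q := by
  obtain ⟨φ, h1, h2⟩ := hP
  exact ⟨φ, h1, fun v => (h2 v).trans (h v)⟩

theorem and {P Q : (Fin k → ℕ) → Prop} (hP : Arithmetical P) (hQ : Arithmetical Q) :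
    Arithmetical fun v => P v ∧ Q v := by
  obtain ⟨φ, h1, h2⟩ := hP
  obtain ⟨ψ, h3, h4⟩ := hQ
  exact ⟨.and φ ψ, ⟨h1, h3⟩, fun v => and_congr (h2 v) (h4 v)⟩

theorem or {P Q : (Fin k → ℕ) → Prop} (hP : Arithmetical P) (hQ : Arithmetical Q) :
    Arithmetical fun v => P v ∨ Q v := by
  obtain ⟨φ, h1, h2⟩ := hP
  obtain ⟨ψ, h3, h4⟩ := hQ
  exact ⟨.or φ ψ, ⟨h1, h3⟩, fun v => or_congr (h2 v) (h4 v)⟩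

theorem imp {P Q : (Fin k → ℕ) → Prop} (hP : Arithmetical P) (hQ : Arithmetical Q) :
    Arithmetical fun v => P v → Q v := by
  obtain ⟨φ, h1, h2⟩ := hP
  obtain ⟨ψ, h3, h4⟩ := hQ
  exact ⟨.imp φ ψ, ⟨h1, h3⟩, fun v => imp_congr (h2 v) (h4 v)⟩

theorem ex {P : ℕ → (Fin k → ℕ) → Prop}
    (hP : Arithmetical fun v : Fin (k + 1) → ℕ => P (v 0) (Fin.tail v)) :
    Arithmetical fun v => ∃ a, P a v := by
  obtain ⟨φ, h1, h2⟩ := hP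
  exact ⟨.ex φ, h1, fun v => exists_congr fun a => h2 _⟩

theorem all {P : ℕ → (Fin k → ℕ) → Prop}
    (hP : Arithmetical fun v : Fin (k + 1) → ℕ => P (v 0) (Fin.tail v)) :
    Arithmetical fun v => ∀ a, P a v := by
  obtain ⟨φ, h1, h2⟩ := hP
  exact ⟨.all φ, h1, fun v => forall_congr' fun a => h2 _⟩

theorem subst {n : ℕ} {P : (Fin n → ℕ) → Prop} (hP : Arithmetical P) (σ : Fin n → Tm k) :
    Arithmetical fun v => P fun i => (σ i).eval v := by
  obtain ⟨φ, h1, h2⟩ := hP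
  exact ⟨φ.subst σ, (φ.isArith_subst σ).2 h1, fun v => (φ.realize_subst σ v).trans (h2 _)⟩

end Arithmetical

/-- The graph of the function is arithmetical. -/
def ArithFun {k : ℕ} (f : (Fin k → ℕ) → ℕ) : Prop :=
  Arithmetical fun v : Fin (k + 1) → ℕ => v 0 = f (Fin.tail v)

theorem ArithFun.term {k : ℕ} {f : (Fin k → ℕ) → ℕ} (t : Tm k) (h : ∀ v, f v = t.eval v) :
    ArithFun f :=
  ⟨.eq (.var 0) t.shift, trivial, fun v => by
    change v 0 = t.shift.eval v ↔ v 0 = f (Fin.tail v)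
    rw [h, ← Tm.eval_shift t (v 0), Fin.cons_self_tail]⟩

theorem Arithmetical.comp {k : ℕ} {f : (Fin k → ℕ) → ℕ} (hf : ArithFun f)
    {P : ℕ → (Fin k → ℕ) → Prop}
    (hP : Arithmetical fun v : Fin (k + 1) → ℕ => P (v 0) (Fin.tail v)) :
    Arithmetical fun v => P (f v) v :=
  (Arithmetical.ex (P := fun a v => a = f v ∧ P a v) (hf.and hP)).congr fun v => by simp

theorem ArithFun.weaken {k : ℕ} {f : (Fin k → ℕ) → ℕ} (hf : ArithFun f) :
    ArithFun fun v : Fin (k + 1) → ℕ => f (Fin.tail v) :=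
  Arithmetical.subst hf (Fin.cons (.var 0) fun i => .var i.succ.succ)

theorem Arithmetical.comp₁ {k : ℕ} {P : ℕ → Prop} (hP : Arithmetical fun v : Fin 1 → ℕ => P (v 0))
    {f : (Fin k → ℕ) → ℕ} (hf : ArithFun f) : Arithmetical fun v => P (f v) :=
  Arithmetical.comp (P := fun a _ => P a) hf (hP.subst ![.var 0])

theorem Arithmetical.comp₂ {k : ℕ} {P : ℕ → ℕ → Prop}
    (hP : Arithmetical fun v : Fin 2 → ℕ => P (v 0) (v 1))
    {f g : (Fin k → ℕ) → ℕ} (hf : ArithFun f) (hg : ArithFun g) :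
    Arithmetical fun v => P (f v) (g v) :=
  Arithmetical.comp (P := fun a v => P a (g v)) hf <|
    Arithmetical.comp (P := fun a v => P (v 0) a) hg.weaken (hP.subst ![.var 1, .var 0])

theorem Arithmetical.comp₃ {k : ℕ} {P : ℕ → ℕ → ℕ → Prop}
    (hP : Arithmetical fun v : Fin 3 → ℕ => P (v 0) (v 1) (v 2))
    {f g h : (Fin k → ℕ) → ℕ} (hf : ArithFun f) (hg : ArithFun g) (hh : ArithFun h) :
    Arithmetical fun v => P (f v) (g v) (h v) :=
  Arithmetical.comp (P := fun a v => P a (g v) (h v)) hf <|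
    Arithmetical.comp (P := fun a v => P (v 0) a (h (Fin.tail v))) hg.weaken <|
      Arithmetical.comp (P := fun a v => P (v 1) (v 0) a) hh.weaken.weaken
        (hP.subst ![.var 2, .var 1, .var 0])

theorem ArithFun.bin {k : ℕ} {F : ℕ → ℕ → ℕ}
    (hF : Arithmetical fun v : Fin 3 → ℕ => v 0 = F (v 1) (v 2))
    {f g : (Fin k → ℕ) → ℕ} (hf : ArithFun f) (hg : ArithFun g) :
    ArithFun fun v => F (f v) (g v) :=
  Arithmetical.comp₃ (P := fun a b c => a = F b c) hF (.term (.var 0) fun _ => rfl)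
    hf.weaken hg.weaken

theorem Arithmetical.eq {k : ℕ} {f g : (Fin k → ℕ) → ℕ} (hf : ArithFun f) (hg : ArithFun g) :
    Arithmetical fun v => f v = g v :=
  Arithmetical.comp₂ (P := fun a b => a = b) ⟨.eq (.var 0) (.var 1), trivial, fun _ => Iff.rfl⟩ hf hg

theorem ArithFun.add {k : ℕ} {f g : (Fin k → ℕ) → ℕ} (hf : ArithFun f) (hg : ArithFun g) :
    ArithFun fun v => f v + g v :=
  .bin ⟨.eq (.var 0) (.add (.var 1) (.var 2)), trivial, fun _ => Iff.rfl⟩ hf hg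

theorem ArithFun.mul {k : ℕ} {f g : (Fin k → ℕ) → ℕ} (hf : ArithFun f) (hg : ArithFun g) :
    ArithFun fun v => f v * g v :=
  .bin ⟨.eq (.var 0) (.mul (.var 1) (.var 2)), trivial, fun _ => Iff.rfl⟩ hf hg

theorem eval_numeral {n : ℕ} (k : ℕ) (e : Fin n → ℕ) : (numeral k).eval e = k := by
  induction k <;> simp_all [numeral, Tm.eval]

theorem ArithFun.const {k : ℕ} (c : ℕ) : ArithFun fun _ : Fin k → ℕ => c :=
  .term (numeral c) fun v => (eval_numeral c v).symm

theorem ArithFun.proj {k : ℕ} (i : Fin k) : ArithFun fun v : Fin k → ℕ => v i :=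
  .term (.var i) fun _ => rfl

theorem Arithmetical.lt {k : ℕ} {f g : (Fin k → ℕ) → ℕ} (hf : ArithFun f) (hg : ArithFun g) :
    Arithmetical fun v => f v < g v :=
  (Arithmetical.ex (P := fun a v => g v = f v + a + 1)
    (.eq hg.weaken (.add (.add hf.weaken (.proj 0)) (.const 1)))).congr fun v => by
    refine ⟨fun ⟨a, h⟩ => by omega, fun h => ⟨g v - f v - 1, by omega⟩⟩

theorem ArithFun.pair {k : ℕ} {f g : (Fin k → ℕ) → ℕ} (hf : ArithFun f) (hg : ArithFun g) :
    ArithFun fun v => Nat.pair (f v) (g v) := by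
  refine .bin (F := Nat.pair) (Arithmetical.congr
    (.or (.and (.lt (.proj 1) (.proj 2)) (.eq (.proj 0) (.add (.mul (.proj 2) (.proj 2)) (.proj 1))))
      (.and (.lt (.proj 2) (.add (.proj 1) (.const 1)))
        (.eq (.proj 0) (.add (.add (.mul (.proj 1) (.proj 1)) (.proj 1)) (.proj 2))))) ?_) hf hg
  intro v
  simp only [Nat.pair]
  split_ifs <;> constructor <;> intro h <;> omega

theorem ArithFun.beta {k : ℕ} {f g : (Fin k → ℕ) → ℕ} (hf : ArithFun f) (hg : ArithFun g) :
    ArithFun fun v => Nat.beta (f v) (g v) := by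
  have : Arithmetical fun v : Fin 3 → ℕ => ∃ a b q, v 1 = Nat.pair a b ∧
      a = q * ((v 2 + 1) * b + 1) + v 0 ∧ v 0 < (v 2 + 1) * b + 1 :=
    .ex <| .ex <| .ex <| .and (.eq (.proj 4) (.pair (.proj 2) (.proj 1))) <| .and
      (.eq (.proj 2) (.add (.mul (.proj 0)
        (.add (.mul (.add (.proj 5) (.const 1)) (.proj 1)) (.const 1))) (.proj 3)))
      (.lt (.proj 3) (.add (.mul (.add (.proj 5) (.const 1)) (.proj 1)) (.const 1)))
  refine .bin (F := Nat.beta) (this.congr fun v => ?_) hf hg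
  constructor
  · rintro ⟨a, b, q, h1, h2, h3⟩
    simp only [Nat.beta, h1, Nat.unpair_pair]
    rw [h2, Nat.mul_add_mod', Nat.mod_eq_of_lt h3]
  · intro h
    refine ⟨(v 1).unpair.1, (v 1).unpair.2, (v 1).unpair.1 / ((v 2 + 1) * (v 1).unpair.2 + 1),
      by simp, ?_, ?_⟩
    · rw [h, Nat.beta, Nat.div_add_mod']
    · rw [h]; exact Nat.mod_lt _ (Nat.succ_pos _)

/-- The set generated from `B` by the rule `S`. -/
inductive Generated (B : ℕ → Prop) (S : ℕ → ℕ → ℕ → Prop) : ℕ → Prop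
  | base {x : ℕ} : B x → Generated B S x
  | step {x y z : ℕ} : Generated B S y → Generated B S z → S x y z → Generated B S x

def IsDerivation (B : ℕ → Prop) (S : ℕ → ℕ → ℕ → Prop) (l : List ℕ) : Prop :=
  ∀ i (hi : i < l.length), B l[i] ∨ ∃ j, ∃ hj : j < i, ∃ k, ∃ hk : k < i, S l[i] l[j] l[k]

theorem IsDerivation.append {B : ℕ → Prop} {S : ℕ → ℕ → ℕ → Prop} {l m : List ℕ}
    (hl : IsDerivation B S l) (hm : IsDerivation B S m) : IsDerivation B S (l ++ m) := by
  intro i hi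
  rcases Nat.lt_or_ge i l.length with h | h
  · rw [List.getElem_append_left h]
    refine (hl i h).imp_right ?_
    rintro ⟨j, hj, k, hk, h⟩
    refine ⟨j, hj, k, hk, ?_⟩
    rwa [List.getElem_append_left (by omega), List.getElem_append_left (by omega)]
  · rw [List.getElem_append_right h]
    rw [List.length_append] at hi
    refine (hm (i - l.length) (by omega)).imp_right ?_
    rintro ⟨j, hj, k, hk, h⟩
    refine ⟨j + l.length, by omega, k + l.length, by omega, ?_⟩
    simpa using h

theorem Generated.exists_derivation {B : ℕ → Prop} {S : ℕ → ℕ → ℕ → Prop} {x : ℕ}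
    (h : Generated B S x) : ∃ l, IsDerivation B S (l ++ [x]) := by
  induction h with
  | @base x hx =>
    refine ⟨[], fun i hi => Or.inl ?_⟩
    obtain rfl : i = 0 := by simpa using hi
    exact hx
  | @step x y z _ _ hS hy hz =>
    obtain ⟨l, hl⟩ := hy
    obtain ⟨m, hm⟩ := hz
    refine ⟨(l ++ [y]) ++ (m ++ [z]), ?_⟩
    have h := hl.append hm
    intro i hi
    rcases Nat.lt_or_ge i ((l ++ [y]) ++ (m ++ [z])).length with h1 | h1
    · rw [List.getElem_append_left h1]
      refine (h i h1).imp_right ?_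
      rintro ⟨j, hj, k, hk, h⟩
      refine ⟨j, hj, k, hk, ?_⟩
      rwa [List.getElem_append_left (hj.trans h1), List.getElem_append_left (hk.trans h1)]
    · refine Or.inr ⟨l.length, ?_, l.length + 1 + m.length, ?_, ?_⟩
      · simp at h1; omega
      · simp at h1; omega
      · have : i = ((l ++ [y]) ++ (m ++ [z])).length := by
          simp at hi h1 ⊢; omega
        subst this
        have e1 : ((l ++ [y]) ++ (m ++ [z]) ++ [x])[l.length]'(by simp) = y := by
          simp
        have e2 : ((l ++ [y]) ++ (m ++ [z]) ++ [x])[l.length + 1 + m.length]'(by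
            simp; omega) = z := by
          rw [List.getElem_append_left (by simp; omega), List.getElem_append_right (by simp)]
          simp
        rw [e1, e2, List.getElem_append_right (le_refl _)]
        simpa using hS

theorem generated_iff {B : ℕ → Prop} {S : ℕ → ℕ → ℕ → Prop} {x : ℕ} : Generated B S x ↔
    ∃ c l, x = Nat.beta c l ∧ ∀ i, i < l + 1 → B (Nat.beta c i) ∨
      ∃ j k, j < i ∧ k < i ∧ S (Nat.beta c i) (Nat.beta c j) (Nat.beta c k) := by
  constructor
  · intro h
    obtain ⟨l, hl⟩ := h.exists_derivation
    have e : ∀ i (hi : i < (l ++ [x]).length), Nat.beta (Nat.unbeta (l ++ [x])) i = (l ++ [x])[i] :=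
      fun i hi => Nat.beta_unbeta_coe (l ++ [x]) ⟨i, hi⟩
    refine ⟨Nat.unbeta (l ++ [x]), l.length, ?_, fun i hi => ?_⟩
    · rw [e _ (by simp)]; simp
    · have hi' : i < (l ++ [x]).length := by simpa using hi
      rw [e i hi']
      refine (hl i hi').imp_right ?_
      rintro ⟨j, hj, k, hk, h⟩
      exact ⟨j, k, hj, hk, by rwa [e j (by omega), e k (by omega)]⟩
  · rintro ⟨c, l, rfl, h⟩
    suffices ∀ i, i < l + 1 → Generated B S (Nat.beta c i) from this l (Nat.lt_succ_self l)
    intro i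
    induction i using Nat.strong_induction_on with
    | _ i ih =>
      intro hi
      rcases h i hi with h | ⟨j, k, hj, hk, h⟩
      · exact .base h
      · exact .step (ih j hj (by omega)) (ih k hk (by omega)) h

theorem Arithmetical.generated {B : ℕ → Prop} {S : ℕ → ℕ → ℕ → Prop}
    (hB : Arithmetical fun v : Fin 1 → ℕ => B (v 0))
    (hS : Arithmetical fun v : Fin 3 → ℕ => S (v 0) (v 1) (v 2)) :
    Arithmetical fun v : Fin 1 → ℕ => Generated B S (v 0) := by
  refine Arithmetical.congr ?_ fun v => generated_iff.symm
  refine .ex <| .ex <| .and (.eq (.proj 2) (.beta (.proj 1) (.proj 0))) <| .all <| .imp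
    (.lt (.proj 0) (.add (.proj 1) (.const 1))) <| .or (hB.comp₁ (.beta (.proj 2) (.proj 0))) <|
    .ex <| .ex <| .and (.lt (.proj 1) (.proj 2)) <| .and (.lt (.proj 0) (.proj 2)) <|
    hS.comp₃ (.beta (.proj 4) (.proj 2)) (.beta (.proj 4) (.proj 1)) (.beta (.proj 4) (.proj 0))

/-- The pairs of a context and the number of a term in it. -/
def TermCode : ℕ → Prop := Generated
  (fun x => ∃ n, (∃ i, i < n ∧ x = Nat.pair n (Nat.pair 0 i)) ∨ x = Nat.pair n (Nat.pair 1 0))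
  (fun x y z => ∃ n a b, y = Nat.pair n a ∧ z = Nat.pair n b ∧ (x = Nat.pair n (Nat.pair 2 a) ∨
    x = Nat.pair n (Nat.pair 3 (Nat.pair a b)) ∨ x = Nat.pair n (Nat.pair 4 (Nat.pair a b))))

theorem termCode_iff {x : ℕ} : TermCode x ↔ ∃ (n : ℕ) (t : Tm n), x = Nat.pair n t.code := by
  constructor
  · intro h
    induction h with
    | base h =>
      obtain ⟨n, ⟨i, hi, rfl⟩ | rfl⟩ := h
      exacts [⟨n, .var ⟨i, hi⟩, rfl⟩, ⟨n, .zero, rfl⟩]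
    | step _ _ h hy hz =>
      obtain ⟨n, a, b, rfl, rfl, h⟩ := h
      obtain ⟨n', s, hs⟩ := hy
      obtain ⟨n'', t, ht⟩ := hz
      obtain ⟨rfl, rfl⟩ := Nat.pair_eq_pair.1 hs
      obtain ⟨rfl, rfl⟩ := Nat.pair_eq_pair.1 ht
      obtain rfl | rfl | rfl := h
      exacts [⟨_, .succ s, rfl⟩, ⟨_, .add s t, rfl⟩, ⟨_, .mul s t, rfl⟩]
  · rintro ⟨n, t, rfl⟩
    induction t with
    | var i => exact .base ⟨n, .inl ⟨i, i.2, rfl⟩⟩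
    | zero => exact .base ⟨n, .inr rfl⟩
    | succ t h => exact .step h h ⟨n, _, _, rfl, rfl, .inl rfl⟩
    | add s t h h' => exact .step h h' ⟨n, _, _, rfl, rfl, .inr (.inl rfl)⟩
    | mul s t h h' => exact .step h h' ⟨n, _, _, rfl, rfl, .inr (.inr rfl)⟩

theorem arithmetical_termCode : Arithmetical fun v : Fin 1 → ℕ => TermCode (v 0) :=
  .generated
    (.ex <| .or (.ex <| .and (.lt (.proj 0) (.proj 1)) (.eq (.proj 2)
      (.pair (.proj 1) (.pair (.const 0) (.proj 0)))))
      (.eq (.proj 1) (.pair (.proj 0) (.const (Nat.pair 1 0)))))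
    (.ex <| .ex <| .ex <| .and (.eq (.proj 4) (.pair (.proj 2) (.proj 1))) <|
      .and (.eq (.proj 5) (.pair (.proj 2) (.proj 0))) <|
      .or (.eq (.proj 3) (.pair (.proj 2) (.pair (.const 2) (.proj 1)))) <|
      .or (.eq (.proj 3) (.pair (.proj 2) (.pair (.const 3) (.pair (.proj 1) (.proj 0)))))
        (.eq (.proj 3) (.pair (.proj 2) (.pair (.const 4) (.pair (.proj 1) (.proj 0))))))

/-- The Gödel numbers of formulas. -/
def FmCode : ℕ → Prop := Generated
  (fun x => ∃ n a b, TermCode (Nat.pair n a) ∧ TermCode (Nat.pair n b) ∧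
    (x = Nat.pair n (Nat.pair 0 (Nat.pair a b)) ∨ x = Nat.pair n (Nat.pair 1 a)))
  (fun x y z => ∃ n a b, (y = Nat.pair n a ∧ z = Nat.pair n b ∧
      ∃ c, (c = 2 ∨ c = 3 ∨ c = 4) ∧ x = Nat.pair n (Nat.pair c (Nat.pair a b))) ∨
    (y = Nat.pair (n + 1) a ∧ (x = Nat.pair n (Nat.pair 5 a) ∨ x = Nat.pair n (Nat.pair 6 a))))

theorem fmCode_iff {x : ℕ} : FmCode x ↔ ∃ (n : ℕ) (A : Fm n), x = A.gn := by
  constructor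
  · intro h
    induction h with
    | base h =>
      obtain ⟨n, a, b, ha, hb, h⟩ := h
      obtain ⟨n', s, hs⟩ := termCode_iff.1 ha
      obtain ⟨n'', t, ht⟩ := termCode_iff.1 hb
      obtain ⟨rfl, rfl⟩ := Nat.pair_eq_pair.1 hs
      obtain ⟨rfl, rfl⟩ := Nat.pair_eq_pair.1 ht
      obtain rfl | rfl := h
      exacts [⟨_, .eq s t, rfl⟩, ⟨_, .box s, rfl⟩]
    | step _ _ h hy hz =>
      obtain ⟨n, a, b, ⟨rfl, rfl, c, hc, rfl⟩ | ⟨rfl, h⟩⟩ := h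
      · obtain ⟨n', s, hs⟩ := hy
        obtain ⟨n'', t, ht⟩ := hz
        obtain ⟨rfl, rfl⟩ := Nat.pair_eq_pair.1 hs
        obtain ⟨rfl, rfl⟩ := Nat.pair_eq_pair.1 ht
        obtain rfl | rfl | rfl := hc
        exacts [⟨_, .and s t, rfl⟩, ⟨_, .or s t, rfl⟩, ⟨_, .imp s t, rfl⟩]
      · obtain ⟨n', s, hs⟩ := hy
        obtain ⟨rfl, rfl⟩ := Nat.pair_eq_pair.1 hs
        obtain rfl | rfl := h
        exacts [⟨_, .all s, rfl⟩, ⟨_, .ex s, rfl⟩]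
  · rintro ⟨n, A, rfl⟩
    induction A with
    | eq s t =>
      exact .base ⟨_, _, _, termCode_iff.2 ⟨_, s, rfl⟩, termCode_iff.2 ⟨_, t, rfl⟩, .inl rfl⟩
    | box t =>
      exact .base ⟨_, _, _, termCode_iff.2 ⟨_, t, rfl⟩, termCode_iff.2 ⟨_, t, rfl⟩, .inr rfl⟩
    | and A B h h' => exact .step h h' ⟨_, _, _, .inl ⟨rfl, rfl, 2, by simp, rfl⟩⟩
    | or A B h h' => exact .step h h' ⟨_, _, _, .inl ⟨rfl, rfl, 3, by simp, rfl⟩⟩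
    | imp A B h h' => exact .step h h' ⟨_, _, _, .inl ⟨rfl, rfl, 4, by simp, rfl⟩⟩
    | all A h => exact .step h h ⟨_, _, 0, .inr ⟨rfl, .inl rfl⟩⟩
    | ex A h => exact .step h h ⟨_, _, 0, .inr ⟨rfl, .inr rfl⟩⟩

theorem arithmetical_fmCode : Arithmetical fun v : Fin 1 → ℕ => FmCode (v 0) :=
  .generated
    (.ex <| .ex <| .ex <| .and (arithmetical_termCode.comp₁ (.pair (.proj 2) (.proj 1))) <|
      .and (arithmetical_termCode.comp₁ (.pair (.proj 2) (.proj 0))) <|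
      .or (.eq (.proj 3) (.pair (.proj 2) (.pair (.const 0) (.pair (.proj 1) (.proj 0)))))
        (.eq (.proj 3) (.pair (.proj 2) (.pair (.const 1) (.proj 1)))))
    (.ex <| .ex <| .ex <| .or
      (.and (.eq (.proj 4) (.pair (.proj 2) (.proj 1))) <|
        .and (.eq (.proj 5) (.pair (.proj 2) (.proj 0))) <| .ex <| .and
          (.or (.eq (.proj 0) (.const 2)) <| .or (.eq (.proj 0) (.const 3))
            (.eq (.proj 0) (.const 4)))
          (.eq (.proj 4) (.pair (.proj 3) (.pair (.proj 0) (.pair (.proj 2) (.proj 1))))))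
      (.and (.eq (.proj 4) (.pair (.add (.proj 2) (.const 1)) (.proj 1))) <|
        .or (.eq (.proj 3) (.pair (.proj 2) (.pair (.const 5) (.proj 1))))
          (.eq (.proj 3) (.pair (.proj 2) (.pair (.const 6) (.proj 1))))))

/-- The pairs of a number and the number of its numeral. -/
def NumCode : ℕ → Prop := Generated (fun x => x = Nat.pair 0 (Nat.pair 1 0))
  (fun x y _ => ∃ w c, y = Nat.pair w c ∧ x = Nat.pair (w + 1) (Nat.pair 2 c))

theorem numCode_iff (n : ℕ) {w c : ℕ} :
    NumCode (Nat.pair w c) ↔ c = (numeral w : Tm n).code := by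
  constructor
  · intro h
    suffices ∀ x, NumCode x → ∃ w, x = Nat.pair w (numeral w : Tm n).code by
      obtain ⟨w', h⟩ := this _ h
      obtain ⟨rfl, rfl⟩ := Nat.pair_eq_pair.1 h
      rfl
    intro x h
    induction h with
    | base h => exact ⟨0, h⟩
    | step _ _ h hy _ =>
      obtain ⟨w, c, rfl, rfl⟩ := h
      obtain ⟨w', h⟩ := hy
      obtain ⟨rfl, rfl⟩ := Nat.pair_eq_pair.1 h
      exact ⟨_, rfl⟩
  · rintro rfl
    induction w with
    | zero => exact .base rfl
    | succ w ih => exact .step ih ih ⟨_, _, rfl, rfl⟩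

theorem arithmetical_numCode : Arithmetical fun v : Fin 1 → ℕ => NumCode (v 0) :=
  .generated (.eq (.proj 0) (.const _))
    (.ex <| .ex <| .and (.eq (.proj 3) (.pair (.proj 1) (.proj 0)))
      (.eq (.proj 2) (.pair (.add (.proj 1) (.const 1)) (.pair (.const 2) (.proj 0)))))

/-- The numeral of `w` replaces the variable `d`. -/
def numSubst (w d n : ℕ) (hd : d ≤ n) (i : Fin (n + 1)) : Tm n :=
  if h : (i : ℕ) < d then .var ⟨i, by omega⟩
  else if h' : (i : ℕ) = d then numeral w else .var ⟨i - 1, by omega⟩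

theorem numeral_shift {n : ℕ} (w : ℕ) : (numeral w : Tm n).shift = numeral w := by
  induction w with
  | zero => rfl
  | succ w ih => exact congrArg Tm.succ ih

theorem liftSubst_numSubst (w d n : ℕ) (hd : d ≤ n) :
    liftSubst (numSubst w d n hd) = numSubst w (d + 1) (n + 1) (by omega) := by
  funext i
  refine Fin.cases ?_ (fun i => ?_) i
  · simp [liftSubst, numSubst]
  · simp only [liftSubst, Fin.cons_succ, numSubst, Fin.val_succ, Nat.add_lt_add_iff_right,
      Nat.add_right_cancel_iff]
    split_ifs with h h'
    · rfl
    · exact numeral_shift w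
    · simp only [Tm.shift, Tm.subst, Tm.var.injEq, Fin.ext_iff, Fin.val_succ]
      omega

theorem numSubst_zero (w n : ℕ) :
    numSubst w 0 n (Nat.zero_le n) = Fin.cons (numeral w) Tm.var := by
  funext i
  refine Fin.cases ?_ (fun i => ?_) i <;> simp [numSubst]

def tuple (w d n a b : ℕ) : ℕ := Nat.pair w (Nat.pair d (Nat.pair n (Nat.pair a b)))

theorem tuple_inj {w d n a b w' d' n' a' b' : ℕ} (h : tuple w d n a b = tuple w' d' n' a' b') :
    w = w' ∧ d = d' ∧ n = n' ∧ a = a' ∧ b = b' := by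
  simpa [tuple, Nat.pair_eq_pair] using h

theorem ArithFun.tuple {k : ℕ} {f g h i j : (Fin k → ℕ) → ℕ} (hf : ArithFun f) (hg : ArithFun g)
    (hh : ArithFun h) (hi : ArithFun i) (hj : ArithFun j) :
    ArithFun fun v => tuple (f v) (g v) (h v) (i v) (j v) :=
  .pair hf (.pair hg (.pair hh (.pair hi hj)))

/-- Substitution of numerals in terms. -/
def TermSub : ℕ → Prop := Generated
  (fun x => ∃ w d n, d < n + 1 ∧
    ((∃ i, i < d ∧ x = tuple w d n (Nat.pair 0 i) (Nat.pair 0 i)) ∨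
      (∃ i, i < n ∧ d < i + 1 ∧ x = tuple w d n (Nat.pair 0 (i + 1)) (Nat.pair 0 i)) ∨
      (∃ c, NumCode (Nat.pair w c) ∧ x = tuple w d n (Nat.pair 0 d) c) ∨
      x = tuple w d n (Nat.pair 1 0) (Nat.pair 1 0)))
  (fun x y z => ∃ w d n a b a' b', y = tuple w d n a a' ∧ z = tuple w d n b b' ∧
    (x = tuple w d n (Nat.pair 2 a) (Nat.pair 2 a') ∨
      ∃ c, (c = 3 ∨ c = 4) ∧
        x = tuple w d n (Nat.pair c (Nat.pair a b)) (Nat.pair c (Nat.pair a' b'))))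

theorem Tm.code_injective {n : ℕ} {s t : Tm n} (h : s.code = t.code) : s = t := by
  induction s generalizing t <;> cases t <;>
    simp_all [Tm.code, Nat.pair_eq_pair, Fin.ext_iff] <;> grind

theorem Fm.code_injective {n : ℕ} {A B : Fm n} (h : A.code = B.code) : A = B := by
  induction A with
  | eq s t =>
    cases B <;> simp_all [Fm.code, Nat.pair_eq_pair]
    exact ⟨Tm.code_injective h.1, Tm.code_injective h.2⟩
  | box t =>
    cases B <;> simp_all [Fm.code, Nat.pair_eq_pair]
    exact Tm.code_injective h
  | _ => cases B <;> simp_all [Fm.code, Nat.pair_eq_pair] <;> grind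

theorem termSub_iff {x : ℕ} : TermSub x ↔ ∃ (w d n : ℕ) (hd : d ≤ n) (t : Tm (n + 1)),
    x = tuple w d n t.code (t.subst (numSubst w d n hd)).code := by
  constructor
  · intro h
    induction h with
    | base h =>
      obtain ⟨w, d, n, hd, ⟨i, hi, rfl⟩ | ⟨i, hi, hi', rfl⟩ | ⟨c, hc, rfl⟩ | rfl⟩ := h
      · exact ⟨w, d, n, by omega, .var ⟨i, by omega⟩, by
          simp [Tm.subst, Tm.code, numSubst, hi]⟩
      · refine ⟨w, d, n, by omega, .var ⟨i + 1, by omega⟩, ?_⟩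
        have h1 : ¬ i + 1 < d := by omega
        have h2 : ¬ i + 1 = d := by omega
        simp [Tm.subst, Tm.code, numSubst, h1, h2]
      · refine ⟨w, d, n, by omega, .var ⟨d, by omega⟩, ?_⟩
        simp [Tm.subst, Tm.code, numSubst, (numCode_iff n).1 hc]
      · exact ⟨w, d, n, by omega, .zero, rfl⟩
    | step _ _ h hy hz =>
      obtain ⟨w, d, n, a, b, a', b', rfl, rfl, h⟩ := h
      obtain ⟨_, _, _, hd, s, hs⟩ := hy
      obtain ⟨_, _, _, hd', t, ht⟩ := hz
      obtain ⟨rfl, rfl, rfl, rfl, rfl⟩ := tuple_inj hs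
      obtain ⟨rfl, rfl, rfl, rfl, rfl⟩ := tuple_inj ht
      obtain rfl | ⟨c, rfl | rfl, rfl⟩ := h
      exacts [⟨_, _, _, hd, .succ s, rfl⟩, ⟨_, _, _, hd, .add s t, rfl⟩,
        ⟨_, _, _, hd, .mul s t, rfl⟩]
  · rintro ⟨w, d, n, hd, t, rfl⟩
    induction t with
    | var i =>
      refine .base ⟨w, d, n, by omega, ?_⟩
      simp only [Tm.subst, numSubst]
      split_ifs with h h'
      · exact .inl ⟨i, h, rfl⟩
      · refine .inr (.inr (.inl ⟨_, (numCode_iff n).2 rfl, ?_⟩))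
        simp [Tm.code, h']
      · refine .inr (.inl ⟨i - 1, by omega, by omega, ?_⟩)
        have : (i : ℕ) - 1 + 1 = i := by omega
        simp [Tm.code, this]
    | zero => exact .base ⟨w, d, n, by omega, .inr (.inr (.inr rfl))⟩
    | succ t h => exact .step h h ⟨_, _, _, _, _, _, _, rfl, rfl, .inl rfl⟩
    | add s t h h' =>
      exact .step h h' ⟨_, _, _, _, _, _, _, rfl, rfl, .inr ⟨3, by simp, rfl⟩⟩
    | mul s t h h' =>
      exact .step h h' ⟨_, _, _, _, _, _, _, rfl, rfl, .inr ⟨4, by simp, rfl⟩⟩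

theorem arithmetical_termSub : Arithmetical fun v : Fin 1 → ℕ => TermSub (v 0) :=
  .generated
    (.ex <| .ex <| .ex <| .and (.lt (.proj 1) (.add (.proj 0) (.const 1))) <|
      .or (.ex <| .and (.lt (.proj 0) (.proj 2)) (.eq (.proj 4) (.tuple (.proj 3) (.proj 2)
        (.proj 1) (.pair (.const 0) (.proj 0)) (.pair (.const 0) (.proj 0))))) <|
      .or (.ex <| .and (.lt (.proj 0) (.proj 1)) <|
        .and (.lt (.proj 2) (.add (.proj 0) (.const 1))) (.eq (.proj 4) (.tuple (.proj 3) (.proj 2)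
        (.proj 1) (.pair (.const 0) (.add (.proj 0) (.const 1)))
        (.pair (.const 0) (.proj 0))))) <|
      .or (.ex <| .and (arithmetical_numCode.comp₁ (.pair (.proj 3) (.proj 0)))
        (.eq (.proj 4) (.tuple (.proj 3) (.proj 2) (.proj 1) (.pair (.const 0) (.proj 2))
          (.proj 0))))
        (.eq (.proj 3) (.tuple (.proj 2) (.proj 1) (.proj 0) (.pair (.const 1) (.const 0))
          (.const (Nat.pair 1 0)))))
    (.ex <| .ex <| .ex <| .ex <| .ex <| .ex <| .ex <|
      .and (.eq (.proj 8) (.tuple (.proj 6) (.proj 5) (.proj 4) (.proj 3) (.proj 1))) <|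
      .and (.eq (.proj 9) (.tuple (.proj 6) (.proj 5) (.proj 4) (.proj 2) (.proj 0))) <|
      .or (.eq (.proj 7) (.tuple (.proj 6) (.proj 5) (.proj 4) (.pair (.const 2) (.proj 3))
        (.pair (.const 2) (.proj 1)))) <|
      .ex <| .and (.or (.eq (.proj 0) (.const 3)) (.eq (.proj 0) (.const 4))) <|
        .eq (.proj 8) (.tuple (.proj 7) (.proj 6) (.proj 5)
          (.pair (.proj 0) (.pair (.proj 4) (.proj 3)))
          (.pair (.proj 0) (.pair (.proj 2) (.proj 1)))))

/-- Substitution of numerals in formulas. -/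
def FmSub : ℕ → Prop := Generated
  (fun x => ∃ w d n a b a' b', TermSub (tuple w d n a a') ∧ TermSub (tuple w d n b b') ∧
    (x = tuple w d n (Nat.pair 1 a) (Nat.pair 1 a') ∨
      x = tuple w d n (Nat.pair 0 (Nat.pair a b)) (Nat.pair 0 (Nat.pair a' b'))))
  (fun x y z => ∃ w d n a b a' b', (y = tuple w d n a a' ∧ z = tuple w d n b b' ∧
      ∃ c, (c = 2 ∨ c = 3 ∨ c = 4) ∧
        x = tuple w d n (Nat.pair c (Nat.pair a b)) (Nat.pair c (Nat.pair a' b'))) ∨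
    (y = tuple w (d + 1) (n + 1) a a' ∧
      ∃ c, (c = 5 ∨ c = 6) ∧ x = tuple w d n (Nat.pair c a) (Nat.pair c a')))

theorem fmSub_iff {x : ℕ} : FmSub x ↔ ∃ (w d n : ℕ) (hd : d ≤ n) (A : Fm (n + 1)),
    x = tuple w d n A.code (A.subst (numSubst w d n hd)).code := by
  constructor
  · intro h
    induction h with
    | base h =>
      obtain ⟨w, d, n, a, b, a', b', ha, hb, h⟩ := h
      obtain ⟨_, _, _, hd, s, hs⟩ := termSub_iff.1 ha
      obtain ⟨_, _, _, hd', t, ht⟩ := termSub_iff.1 hb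
      obtain ⟨rfl, rfl, rfl, rfl, rfl⟩ := tuple_inj hs
      obtain ⟨rfl, rfl, rfl, rfl, rfl⟩ := tuple_inj ht
      obtain rfl | rfl := h
      exacts [⟨_, _, _, hd, .box s, rfl⟩, ⟨_, _, _, hd, .eq s t, rfl⟩]
    | step _ _ h hy hz =>
      obtain ⟨w, d, n, a, b, a', b', ⟨rfl, rfl, c, hc, rfl⟩ | ⟨rfl, c, hc, rfl⟩⟩ := h
      · obtain ⟨_, _, _, hd, s, hs⟩ := hy
        obtain ⟨_, _, _, hd', t, ht⟩ := hz
        obtain ⟨rfl, rfl, rfl, rfl, rfl⟩ := tuple_inj hs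
        obtain ⟨rfl, rfl, rfl, rfl, rfl⟩ := tuple_inj ht
        obtain rfl | rfl | rfl := hc
        exacts [⟨_, _, _, hd, .and s t, rfl⟩, ⟨_, _, _, hd, .or s t, rfl⟩,
          ⟨_, _, _, hd, .imp s t, rfl⟩]
      · obtain ⟨_, _, _, hd, s, hs⟩ := hy
        obtain ⟨rfl, rfl, rfl, rfl, rfl⟩ := tuple_inj hs
        obtain rfl | rfl := hc
        · refine ⟨w, d, n, Nat.le_of_succ_le_succ hd, .all s, ?_⟩
          simp only [Fm.subst, liftSubst_numSubst, Fm.code]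
        · refine ⟨w, d, n, Nat.le_of_succ_le_succ hd, .ex s, ?_⟩
          simp only [Fm.subst, liftSubst_numSubst, Fm.code]
  · rintro ⟨w, d, n, hd, A, rfl⟩
    suffices ∀ {m : ℕ} (A : Fm m) (d n : ℕ) (hd : d ≤ n) (hm : m = n + 1),
        FmSub (tuple w d n A.code ((hm ▸ A : Fm (n + 1)).subst (numSubst w d n hd)).code) from
      this A d n hd rfl
    intro m A
    induction A with
    | eq s t =>
      intro d n hd hm
      subst hm
      exact .base ⟨_, _, _, _, _, _, _, termSub_iff.2 ⟨w, d, n, hd, s, rfl⟩,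
        termSub_iff.2 ⟨w, d, n, hd, t, rfl⟩, .inr rfl⟩
    | box t =>
      intro d n hd hm
      subst hm
      exact .base ⟨_, _, _, _, _, _, _, termSub_iff.2 ⟨w, d, n, hd, t, rfl⟩,
        termSub_iff.2 ⟨w, d, n, hd, t, rfl⟩, .inl rfl⟩
    | and A B h h' =>
      intro d n hd hm
      subst hm
      exact .step (h d n hd rfl) (h' d n hd rfl)
        ⟨_, _, _, _, _, _, _, .inl ⟨rfl, rfl, 2, by simp, rfl⟩⟩
    | or A B h h' =>
      intro d n hd hm
      subst hm
      exact .step (h d n hd rfl) (h' d n hd rfl)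
        ⟨_, _, _, _, _, _, _, .inl ⟨rfl, rfl, 3, by simp, rfl⟩⟩
    | imp A B h h' =>
      intro d n hd hm
      subst hm
      exact .step (h d n hd rfl) (h' d n hd rfl)
        ⟨_, _, _, _, _, _, _, .inl ⟨rfl, rfl, 4, by simp, rfl⟩⟩
    | all A h =>
      intro d n hd hm
      subst hm
      have := h (d + 1) (n + 1) (by omega) rfl
      exact .step this this ⟨_, _, _, _, 0, _, 0, .inr ⟨rfl, 5, by simp, by
        simp only [Fm.subst, liftSubst_numSubst, Fm.code]⟩⟩
    | ex A h =>
      intro d n hd hm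
      subst hm
      have := h (d + 1) (n + 1) (by omega) rfl
      exact .step this this ⟨_, _, _, _, 0, _, 0, .inr ⟨rfl, 6, by simp, by
        simp only [Fm.subst, liftSubst_numSubst, Fm.code]⟩⟩

theorem arithmetical_fmSub : Arithmetical fun v : Fin 1 → ℕ => FmSub (v 0) :=
  .generated
    (.ex <| .ex <| .ex <| .ex <| .ex <| .ex <| .ex <|
      .and (arithmetical_termSub.comp₁
        (.tuple (.proj 6) (.proj 5) (.proj 4) (.proj 3) (.proj 1))) <|
      .and (arithmetical_termSub.comp₁
        (.tuple (.proj 6) (.proj 5) (.proj 4) (.proj 2) (.proj 0))) <|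
      .or (.eq (.proj 7) (.tuple (.proj 6) (.proj 5) (.proj 4) (.pair (.const 1) (.proj 3))
        (.pair (.const 1) (.proj 1))))
        (.eq (.proj 7) (.tuple (.proj 6) (.proj 5) (.proj 4)
          (.pair (.const 0) (.pair (.proj 3) (.proj 2)))
          (.pair (.const 0) (.pair (.proj 1) (.proj 0))))))
    (.ex <| .ex <| .ex <| .ex <| .ex <| .ex <| .ex <| .or
      (.and (.eq (.proj 8) (.tuple (.proj 6) (.proj 5) (.proj 4) (.proj 3) (.proj 1))) <|
        .and (.eq (.proj 9) (.tuple (.proj 6) (.proj 5) (.proj 4) (.proj 2) (.proj 0))) <|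
        .ex <| .and (.or (.eq (.proj 0) (.const 2)) <| .or (.eq (.proj 0) (.const 3))
            (.eq (.proj 0) (.const 4))) <|
          .eq (.proj 8) (.tuple (.proj 7) (.proj 6) (.proj 5)
            (.pair (.proj 0) (.pair (.proj 4) (.proj 3)))
            (.pair (.proj 0) (.pair (.proj 2) (.proj 1)))))
      (.and (.eq (.proj 8) (.tuple (.proj 6) (.add (.proj 5) (.const 1))
          (.add (.proj 4) (.const 1)) (.proj 3) (.proj 1))) <|
        .ex <| .and (.or (.eq (.proj 0) (.const 5)) (.eq (.proj 0) (.const 6))) <|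
          .eq (.proj 8) (.tuple (.proj 7) (.proj 6) (.proj 5)
            (.pair (.proj 0) (.proj 4)) (.pair (.proj 0) (.proj 2)))))

theorem fmCode_pair {n a : ℕ} : FmCode (Nat.pair n a) ↔ ∃ A : Fm n, a = A.code := by
  rw [fmCode_iff]
  constructor
  · rintro ⟨m, A, h⟩
    obtain ⟨rfl, rfl⟩ := Nat.pair_eq_pair.1 h
    exact ⟨A, rfl⟩
  · rintro ⟨A, rfl⟩
    exact ⟨n, A, rfl⟩

theorem arithmetical_connective (c : ℕ) (f : Sentence → Sentence → Sentence)
    (hf : ∀ A B, (f A B).gn = Nat.pair 0 (Nat.pair c (Nat.pair A.code B.code))) :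
    Arithmetical fun v : Fin 3 → ℕ =>
      ∃ A B : Sentence, v 0 = A.gn ∧ v 1 = B.gn ∧ v 2 = (f A B).gn := by
  have : Arithmetical fun v : Fin 3 → ℕ => ∃ a b, (FmCode (Nat.pair 0 a) ∧
      FmCode (Nat.pair 0 b)) ∧ v 0 = Nat.pair 0 a ∧ v 1 = Nat.pair 0 b ∧
        v 2 = Nat.pair 0 (Nat.pair c (Nat.pair a b)) :=
    .ex <| .ex <| .and (.and (arithmetical_fmCode.comp₁ (.pair (.const 0) (.proj 1)))
      (arithmetical_fmCode.comp₁ (.pair (.const 0) (.proj 0)))) <|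
      .and (.eq (.proj 2) (.pair (.const 0) (.proj 1))) <|
      .and (.eq (.proj 3) (.pair (.const 0) (.proj 0)))
        (.eq (.proj 4) (.pair (.const 0) (.pair (.const c) (.pair (.proj 1) (.proj 0)))))
  refine this.congr fun v => ?_
  simp only [fmCode_pair, hf]
  simp only [Fm.gn]
  constructor
  · rintro ⟨_, _, ⟨⟨A, rfl⟩, B, rfl⟩, h⟩
    exact ⟨A, B, h⟩
  · rintro ⟨A, B, h⟩
    exact ⟨_, _, ⟨⟨A, rfl⟩, B, rfl⟩, h⟩

theorem arithmetical_quantifier (c : ℕ) (f : Fm 1 → Sentence)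
    (hf : ∀ A, (f A).gn = Nat.pair 0 (Nat.pair c A.code)) :
    Arithmetical fun v : Fin 2 → ℕ => ∃ A : Fm 1, v 0 = A.gn ∧ v 1 = (f A).gn := by
  have : Arithmetical fun v : Fin 2 → ℕ => ∃ a, FmCode (Nat.pair 1 a) ∧ v 0 = Nat.pair 1 a ∧
      v 1 = Nat.pair 0 (Nat.pair c a) :=
    .ex <| .and (arithmetical_fmCode.comp₁ (.pair (.const 1) (.proj 0))) <|
      .and (.eq (.proj 1) (.pair (.const 1) (.proj 0)))
        (.eq (.proj 2) (.pair (.const 0) (.pair (.const c) (.proj 0))))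
  refine this.congr fun v => ?_
  simp only [fmCode_pair, hf]
  simp only [Fm.gn]
  constructor
  · rintro ⟨_, ⟨A, rfl⟩, h⟩
    exact ⟨A, h⟩
  · rintro ⟨A, h⟩
    exact ⟨_, ⟨A, rfl⟩, h⟩

theorem arithmetical_sub : Arithmetical fun v : Fin 3 → ℕ =>
    ∃ (k : ℕ) (A : Fm (k + 1)), v 0 = A.gn ∧ v 2 = (A.inst (numeral (v 1))).gn := by
  have : Arithmetical fun v : Fin 3 → ℕ => ∃ k a b, FmSub (tuple (v 1) 0 k a b) ∧
      v 0 = Nat.pair (k + 1) a ∧ v 2 = Nat.pair k b :=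
    .ex <| .ex <| .ex <| .and (arithmetical_fmSub.comp₁
      (.tuple (.proj 4) (.const 0) (.proj 2) (.proj 1) (.proj 0))) <|
      .and (.eq (.proj 3) (.pair (.add (.proj 2) (.const 1)) (.proj 1)))
        (.eq (.proj 5) (.pair (.proj 2) (.proj 0)))
  refine this.congr fun v => ?_
  constructor
  · rintro ⟨k, a, b, h, h1, h2⟩
    obtain ⟨w, d, n, hd, A, h⟩ := fmSub_iff.1 h
    obtain ⟨rfl, rfl, rfl, rfl, rfl⟩ := tuple_inj h
    refine ⟨k, A, h1, ?_⟩
    rw [h2, numSubst_zero]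
    rfl
  · rintro ⟨k, A, h1, h2⟩
    refine ⟨k, _, _, fmSub_iff.2 ⟨v 1, 0, k, Nat.zero_le k, A, rfl⟩, h1, ?_⟩
    rw [h2, numSubst_zero]
    rfl

/-- Formulas as required in `Arithmetization` exist. -/
theorem nonempty_arithmetization : Nonempty Arithmetization := by
  obtain ⟨orF, h1⟩ := arithmetical_connective 3 Fm.or fun _ _ => rfl
  obtain ⟨andF, h2⟩ := arithmetical_connective 2 Fm.and fun _ _ => rfl
  obtain ⟨impF, h3⟩ := arithmetical_connective 4 Fm.imp fun _ _ => rfl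
  obtain ⟨allF, h4⟩ := arithmetical_quantifier 5 Fm.all fun _ => rfl
  obtain ⟨exF, h5⟩ := arithmetical_quantifier 6 Fm.ex fun _ => rfl
  obtain ⟨subF, h6⟩ := arithmetical_sub
  exact ⟨⟨orF, andF, impF, allF, exF, subF, h1, h2, h3, h4, h5, h6⟩⟩

end Assert

namespace Assert

/-! ### A Kripke model

The worlds are the natural numbers, the domain is constantly `ℕ`, and a world `w` sees the worlds
`v ≤ w`. World `0` forces everything, and `□⌜A⌝` is forced at `w + 1` if `A` is forced at `w`.
In the worlds `w + 1`, a formula of first order arithmetic is forced if and only if it is true. -/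

/-! The theories are separated by a descending tower of worlds. The bottom world `0` explodes: it
forces `⊥` and everything else. Above it, atomic equations are evaluated in `ℕ`, and `□` means
"forced one world further down". Since the tower is linearly ordered, the domain is constantly `ℕ`,
and forcing persists downwards, the connectives `∧`, `∨` and both quantifiers are evaluated locally
at each world; only `→` looks at lower worlds.

This makes the axioms for `□` hold. Shifting down by one world commutes with the local connectives,
which gives (1)–(4); it preserves modus ponens, which gives (5); and capture (6) is exactly
persistence (`Forces.pred`). Induction holds for all formulas because the domain is the standard
one. Arithmetical formulas have their standard truth value in every world except `0`
(`forces_succ_of_isArith`), so soundness of `S` puts its axioms in every world, classical ones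
included. Hence every main axiom is forced in every world (`forces_mainAxiom`), in particular one
world below any given one, and this is what the jump axiom asserts (`forces_boxSystem`).

Theorems are therefore forced everywhere. But `k` boxes evaluated at the world `k + 1` descend to
the world `1` (`forces_boxPow`), where a false arithmetical sentence is not forced. No single world
serves for all `k`, because at the world `k` the sentence with `k` boxes is forced for the trivial
reason that it refers to the world `0`.

Forcing is defined by recursion on the world first and the formula second, since `□` refers to
sentences unrelated in complexity to the formula it occurs in. A number that is not the code of a
sentence satisfies `□` vacuously. -/

/-- Forcing at the world `w + 1`, where `P` is forcing at the world `w`. -/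
def forceStep (P : {n : ℕ} → Fm n → (Fin n → ℕ) → Prop) :
    {n : ℕ} → Fm n → (Fin n → ℕ) → Prop
  | _, .eq s t, e => s.eval e = t.eval e
  | _, .box t, e => ∀ B : Sentence, t.eval e = B.gn → P B Fin.elim0
  | _, .and A B, e => forceStep P A e ∧ forceStep P B e
  | _, .or A B, e => forceStep P A e ∨ forceStep P B e
  | _, .imp A B, e => (forceStep P A e → forceStep P B e) ∧ P (.imp A B) e
  | _, .all A, e => ∀ k : ℕ, forceStep P A (Fin.cons k e)
  | _, .ex A, e => ∃ k : ℕ, forceStep P A (Fin.cons k e)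

/-- The formula `A` is forced at the world `w` under the assignment `e`. -/
def Forces : ℕ → {n : ℕ} → Fm n → (Fin n → ℕ) → Prop
  | 0, _, _, _ => True
  | w + 1, _, A, e => forceStep (Forces w) A e

/-! ### Forcing clauses, uniform in the world -/

theorem forces_zero {n : ℕ} (A : Fm n) (e : Fin n → ℕ) : Forces 0 A e := trivial

theorem forces_succ_eq {w n : ℕ} (s t : Tm n) (e : Fin n → ℕ) :
    Forces (w + 1) (.eq s t) e ↔ s.eval e = t.eval e := Iff.rfl

theorem forces_and {w n : ℕ} (A B : Fm n) (e : Fin n → ℕ) :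
    Forces w (.and A B) e ↔ Forces w A e ∧ Forces w B e := by
  cases w
  · simp [forces_zero]
  · rfl

theorem forces_or {w n : ℕ} (A B : Fm n) (e : Fin n → ℕ) :
    Forces w (.or A B) e ↔ Forces w A e ∨ Forces w B e := by
  cases w
  · simp [forces_zero]
  · rfl

theorem forces_all {w n : ℕ} (A : Fm (n + 1)) (e : Fin n → ℕ) :
    Forces w (.all A) e ↔ ∀ k : ℕ, Forces w A (Fin.cons k e) := by
  cases w
  · simp [forces_zero]
  · rfl

theorem forces_ex {w n : ℕ} (A : Fm (n + 1)) (e : Fin n → ℕ) :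
    Forces w (.ex A) e ↔ ∃ k : ℕ, Forces w A (Fin.cons k e) := by
  cases w
  · simp [forces_zero]
  · rfl

theorem forces_succ_imp {w n : ℕ} (A B : Fm n) (e : Fin n → ℕ) :
    Forces (w + 1) (.imp A B) e ↔
      (Forces (w + 1) A e → Forces (w + 1) B e) ∧ Forces w (.imp A B) e := Iff.rfl

/-- Unrolling the second conjunct of the recursive clause down to the world `0` recovers the usual
Kripke clause. -/
theorem forces_imp {w n : ℕ} (A B : Fm n) (e : Fin n → ℕ) :
    Forces w (.imp A B) e ↔ ∀ v ≤ w, Forces v A e → Forces v B e := by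
  induction w with
  | zero => simp [forces_zero]
  | succ w ih =>
    rw [forces_succ_imp, ih]
    simp only [Nat.le_succ_iff_eq_or_le, forall_eq_or_imp]

theorem Fm.gn_injective {n : ℕ} {A B : Fm n} (h : A.gn = B.gn) : A = B :=
  Fm.code_injective (Nat.pair_eq_pair.1 h).2

/-- Gödel numbers are injective, so the quantifier over sentences in the clause for `□` ranges over
`A` alone. Truncated subtraction lets the world `0` see itself, which is harmless since it forces
everything. -/
theorem forces_box {w n : ℕ} {t : Tm n} {e : Fin n → ℕ} {A : Sentence} (h : t.eval e = A.gn) :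
    Forces w (.box t) e ↔ Forces (w - 1) A Fin.elim0 := by
  cases w with
  | zero => simp [forces_zero]
  | succ w =>
    refine ⟨fun h' => h' A h, fun h' B hB => ?_⟩
    rwa [← Fm.gn_injective (h.symm.trans hB)]

/-! ### Persistence -/

theorem Forces.pred : ∀ {w n : ℕ} {A : Fm n} {e : Fin n → ℕ}, Forces (w + 1) A e → Forces w A e
  | 0, _, _, _, _ => trivial
  | w + 1, n, A, e, h => by
    induction A with
    | eq s t => exact h
    -- The sentence `B` is arbitrary, out of reach of the induction on the formula; the outer
    -- recursion on the world handles it.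
    | box t => exact fun B hB => (h B hB).pred
    | and A B hA hB => exact ⟨hA _ h.1, hB _ h.2⟩
    | or A B hA hB => exact h.imp (hA _) (hB _)
    | imp A B => exact h.2
    | all A hA => exact fun k => hA _ (h k)
    | ex A hA => exact h.imp fun k => hA _

theorem Forces.sub_one {w n : ℕ} {A : Fm n} {e : Fin n → ℕ} (h : Forces w A e) :
    Forces (w - 1) A e := by
  cases w
  exacts [h, h.pred]

theorem Forces.mono {w v n : ℕ} {A : Fm n} {e : Fin n → ℕ} (h : Forces w A e) (hv : v ≤ w) :
    Forces v A e := by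
  induction hv with
  | refl => exact h
  | step _ ih => exact ih h.pred

/-! ### Substitution and universal closures -/

theorem forces_subst {n : ℕ} (A : Fm n) : ∀ {w m : ℕ} (σ : Fin n → Tm m) (e : Fin m → ℕ),
    Forces w (A.subst σ) e ↔ Forces w A fun i => (σ i).eval e := by
  induction A with
  | eq s t => intro w; cases w <;> simp [Fm.subst, Forces, forceStep, Tm.eval_subst]
  | box t => intro w; cases w <;> simp [Fm.subst, Forces, forceStep, Tm.eval_subst]
  | and A B hA hB => simp [Fm.subst, forces_and, hA, hB]
  | or A B hA hB => simp [Fm.subst, forces_or, hA, hB]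
  | imp A B hA hB => simp [Fm.subst, forces_imp, hA, hB]
  | all A hA => simp [Fm.subst, forces_all, hA, eval_liftSubst]
  | ex A hA => simp [Fm.subst, forces_ex, hA, eval_liftSubst]

theorem eval_cons_var {n : ℕ} (t : Tm n) (e : Fin n → ℕ) :
    (fun i => ((Fin.cons t Tm.var : Fin (n + 1) → Tm n) i).eval e) = Fin.cons (t.eval e) e := by
  funext i
  refine Fin.cases ?_ (fun i => ?_) i <;> simp [Tm.eval]

theorem forces_inst {w n : ℕ} (A : Fm (n + 1)) (t : Tm n) (e : Fin n → ℕ) :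
    Forces w (A.inst t) e ↔ Forces w A (Fin.cons (t.eval e) e) := by
  rw [Fm.inst, forces_subst, eval_cons_var]

theorem forces_shift {w n : ℕ} (A : Fm n) (k : ℕ) (e : Fin n → ℕ) :
    Forces w A.shift (Fin.cons k e) ↔ Forces w A e := by
  simp [Fm.shift, forces_subst, Tm.eval]

theorem forces_instSucc {w n : ℕ} (A : Fm (n + 1)) (k : ℕ) (e : Fin n → ℕ) :
    Forces w A.instSucc (Fin.cons k e) ↔ Forces w A (Fin.cons (k + 1) e) := by
  rw [Fm.instSucc, forces_subst]
  refine iff_of_eq (congrArg _ (funext fun i => ?_))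
  refine Fin.cases ?_ (fun i => ?_) i <;> simp [Tm.eval]

theorem forces_close {w n : ℕ} (A : Fm n) :
    Forces w A.close Fin.elim0 ↔ ∀ e, Forces w A e := by
  induction n with
  | zero => exact ⟨fun h e => Subsingleton.elim Fin.elim0 e ▸ h, fun h => h _⟩
  | succ n ih =>
    simp only [Fm.close, ih, forces_all]
    exact ⟨fun h e => Fin.cons_self_tail e ▸ h _ _, fun h e k => h _⟩

/-- The single world `w` suffices because the constant domain makes universal quantifiers local. It
lets the two generalization axioms be checked beneath their common outer block. -/
theorem Forces.alls_mono {w m : ℕ} : ∀ {k : ℕ} {A B : Fm (m + k)},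
    (∀ e, Forces w A e → Forces w B e) → ∀ {e}, Forces w (Fm.alls k A) e →
      Forces w (Fm.alls k B) e
  | 0, _, _, h, _, hA => h _ hA
  | k + 1, _, _, h, _, hA => Forces.alls_mono (k := k)
      (fun e h' => (forces_all _ e).2 fun i => h _ ((forces_all _ e).1 h' i)) hA

/-! ### Arithmetical formulas and boxed instances -/

/-- In the worlds `w + 1`, formulas of first order arithmetic are interpreted in the standard
model. -/
theorem forces_succ_of_isArith {n : ℕ} {A : Fm n} (hA : A.IsArith) (w : ℕ) (e : Fin n → ℕ) :
    Forces (w + 1) A e ↔ A.Realize e := by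
  induction A generalizing w with
  | eq s t => rfl
  | box t => exact hA.elim
  | and A B h h' => simp only [forces_and, Fm.Realize, h hA.1, h' hA.2]
  | or A B h h' => simp only [forces_or, Fm.Realize, h hA.1, h' hA.2]
  | imp A B h h' =>
    rw [forces_imp, Fm.Realize]
    refine ⟨fun H h1 => (h' hA.2 w e).1 (H _ le_rfl ((h hA.1 w e).2 h1)), fun H v _ h1 => ?_⟩
    -- An implication also looks at the exploding world `0`, but its conclusion is forced there.
    cases v
    exacts [trivial, (h' hA.2 _ e).2 (H ((h hA.1 _ e).1 h1))]
  | all A h => simp only [forces_all, Fm.Realize, h hA]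
  | ex A h => simp only [forces_ex, Fm.Realize, h hA]

theorem forces_of_isTrue {A : Sentence} (hA : A.IsArith) (h : A.IsTrue) (w : ℕ) :
    Forces w A Fin.elim0 := by
  cases w
  exacts [trivial, (forces_succ_of_isArith hA _ _).2 h]

/-- The formula `□⌜A(n̄_0, …, n̄_{k-1})⌝` is interpreted as intended. -/
theorem forces_boxInst (R : Arithmetization) {w k : ℕ} : ∀ {m : ℕ} (s : Fin k → Tm m) (t : Tm m)
    (A : Fm k) (e : Fin m → ℕ), t.eval e = A.gn →
      (Forces w (R.boxInst k s t) e ↔ Forces (w - 1) A fun i => (s i).eval e) := by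
  -- The formula `subF` has its intended meaning only in positive worlds, so the world `0` is split
  -- off.
  obtain _ | w := w
  · simp [forces_zero]
  induction k with
  | zero =>
    intro m s t A e h
    rw [Arithmetization.boxInst, forces_box h, Subsingleton.elim Fin.elim0 fun i => (s i).eval e]
  | succ k ih =>
    intro m s t A e h
    -- The code of the instance is unique, so the existential quantifier in `boxInst` disappears and
    -- one variable of `A` has been replaced by a numeral.
    have hsub (a : ℕ) : Forces (w + 1) (R.subF.subst ![t.shift, (s 0).shift, .var 0])
        (Fin.cons a e) ↔ a = (A.inst (numeral ((s 0).eval e))).gn := by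
      rw [forces_subst, forces_succ_of_isArith R.subF_spec.1, R.subF_spec.2]
      simp only [Matrix.cons_val_zero, Matrix.cons_val_one, Matrix.cons_val, Tm.eval_shift, h,
        Tm.eval, Fin.cons_zero]
      constructor
      · rintro ⟨k', A', h1, h2⟩
        -- The Gödel number records the length of the context, so equal codes have equally many
        -- variables.
        obtain rfl : k = k' := by simpa using (Nat.pair_eq_pair.1 h1).1
        rw [h2, Fm.gn_injective h1]
      · exact fun h => ⟨k, A, rfl, h⟩
    simp only [Arithmetization.boxInst, forces_ex, forces_and, hsub, exists_eq_left]
    rw [ih _ _ (A.inst (numeral ((s 0).eval e))) _ rfl, forces_inst, eval_numeral]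
    simp only [Tm.eval_shift]
    refine iff_of_eq (congrArg _ (funext fun i => ?_))
    refine Fin.cases ?_ (fun i => ?_) i <;> simp

theorem forces_boxInst_one (R : Arithmetization) {w m : ℕ} (A : Fm 1) (k : ℕ)
    (e : Fin (m + 1) → ℕ) (h : e 0 = A.gn) :
    Forces w (R.boxInst 1 ![.var 0] (.var 1)) (Fin.cons k e) ↔
      Forces (w - 1) A (Fin.cons k Fin.elim0) := by
  refine (forces_boxInst R ![.var 0] (.var 1) A (Fin.cons k e) h).trans ?_
  refine iff_of_eq (congrArg _ (funext fun i => ?_))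
  rw [Subsingleton.elim i 0]
  rfl

/-! ### Soundness -/

theorem forces_logicalAxiom {n : ℕ} {A : Fm n} (h : LogicalAxiom A) (w : ℕ) (e : Fin n → ℕ) :
    Forces w A e := by
  cases h with
  | imp_k A B =>
    simp only [forces_imp]
    exact fun v _ h u hu _ => h.mono hu
  | imp_s A B C =>
    simp only [forces_imp]
    exact fun v _ h u hu h' x hx hA => h x (hx.trans hu) hA x le_rfl (h' x hx hA)
  | and_intro A B =>
    simp only [forces_imp, forces_and]
    exact fun v _ h u hu h' => ⟨h.mono hu, h'⟩
  | and_left A B =>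
    simp only [forces_imp, forces_and]
    exact fun v _ h => h.1
  | and_right A B =>
    simp only [forces_imp, forces_and]
    exact fun v _ h => h.2
  | or_left A B =>
    simp only [forces_imp, forces_or]
    exact fun v _ h => .inl h
  | or_right A B =>
    simp only [forces_imp, forces_or]
    exact fun v _ h => .inr h
  | or_elim A B C =>
    simp only [forces_imp, forces_or]
    exact fun v _ h u hu h' x hx => Or.rec (h x (hx.trans hu)) (h' x hx)
  | ex_falso A =>
    rw [forces_imp]
    rintro (_ | v) _ h
    · trivial
    · exact absurd h Nat.zero_ne_one
  | all_inst A t =>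
    simp only [forces_imp, forces_all, forces_inst]
    exact fun v _ h => h _
  | ex_intro A t =>
    simp only [forces_imp, forces_ex, forces_inst]
    exact fun v _ h => ⟨_, h⟩
  | all_gen k A B =>
    rw [forces_imp]
    -- A block of `k + 1` quantifiers is by definition a block of `k` over one more, so both sides
    -- share the outer block.
    refine fun v _ => Forces.alls_mono (k := k) fun e => ?_
    simp only [forces_all, forces_imp, forces_shift]
    exact fun h u hu hA i => h i u hu hA
  | ex_gen k A B =>
    rw [forces_imp]
    refine fun v _ => Forces.alls_mono (k := k) fun e => ?_
    simp only [forces_all, forces_ex, forces_imp, forces_shift]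
    exact fun h u hu ⟨i, hA⟩ => h i u hu hA
  | eq_refl t =>
    cases w
    exacts [trivial, rfl]
  | eq_subst A s t =>
    rw [forces_imp]
    rintro (_ | v) _ h
    · trivial
    · simp only [forces_imp, forces_inst, (forces_succ_eq s t e).1 h]
      exact fun _ _ => id

/-- The domain is `ℕ`, so ordinary induction at a fixed world `u` applies to any formula, with or
without `□`; the case of zero persists down to `u`. -/
theorem forces_inductionAxiom {n : ℕ} (A : Fm (n + 1)) (w : ℕ) (e : Fin n → ℕ) :
    Forces w (inductionAxiom A) e := by
  simp only [inductionAxiom, forces_imp, forces_all, forces_inst, forces_instSucc, Tm.eval]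
  intro v _ h0 u hu hs k
  induction k with
  | zero => exact h0.mono hu
  | succ k ih => exact hs k u le_rfl ih

/-- An implication with an arithmetical premise is forced if its conclusion is forced under
every assignment which satisfies the premise. -/
theorem forces_imp_of_expresses {n : ℕ} {φ B : Fm n} {P : (Fin n → ℕ) → Prop}
    (hφ : Expresses φ P) {e : Fin n → ℕ} (h : P e → ∀ v, Forces v B e) (w : ℕ) :
    Forces w (.imp φ B) e := by
  rw [forces_imp]
  rintro (_ | v) _ h'
  · trivial
  · exact h ((hφ.2 e).1 ((forces_succ_of_isArith hφ.1 v e).1 h')) _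

theorem forces_boxAxiom {R : Arithmetization} {A : Sentence} (h : BoxAxiom R A) (w : ℕ) :
    Forces w A Fin.elim0 := by
  cases h with
  | or =>
    refine (forces_close _).2 fun e => forces_imp_of_expresses R.orF_spec ?_ w
    rintro ⟨A, B, h0, h1, h2⟩ v
    simp only [Fm.iff, forces_and, forces_or, forces_imp, forces_box (t := .var 0) h0,
      forces_box (t := .var 1) h1, forces_box (t := .var 2) h2]
    -- Both sides have become the same statement about the world one step down.
    exact ⟨fun _ _ => id, fun _ _ => id⟩
  | and =>
    refine (forces_close _).2 fun e => forces_imp_of_expresses R.andF_spec ?_ w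
    rintro ⟨A, B, h0, h1, h2⟩ v
    simp only [Fm.iff, forces_and, forces_imp, forces_box (t := .var 0) h0,
      forces_box (t := .var 1) h1, forces_box (t := .var 2) h2]
    exact ⟨fun _ _ => id, fun _ _ => id⟩
  | ex =>
    refine (forces_close _).2 fun e => forces_imp_of_expresses R.exF_spec ?_ w
    rintro ⟨A, h0, h1⟩ v
    simp only [forces_imp, forces_ex, forces_box (t := .var 1) h1,
      fun u i => forces_boxInst_one R (w := u) A i e h0]
    exact fun _ _ => id
  | all =>
    refine (forces_close _).2 fun e => forces_imp_of_expresses R.allF_spec ?_ w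
    rintro ⟨A, h0, h1⟩ v
    simp only [Fm.iff, forces_and, forces_imp, forces_all, forces_box (t := .var 1) h1,
      fun u i => forces_boxInst_one R (w := u) A i e h0]
    exact ⟨fun _ _ => id, fun _ _ => id⟩
  | imp =>
    refine (forces_close _).2 fun e => forces_imp_of_expresses R.impF_spec ?_ w
    rintro ⟨A, B, h0, h1, h2⟩ v
    simp only [forces_imp, forces_box (t := .var 0) h0, forces_box (t := .var 1) h1,
      forces_box (t := .var 2) h2]
    -- The implication forced at `u - 1` is applied at `x - 1`, where its premise is known.
    exact fun u _ h x hx => h _ (Nat.sub_le_sub_right hx 1)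
  | capture A =>
    refine (forces_close _).2 fun e => (forces_imp _ _ _).2 fun v _ h => ?_
    -- Capture is persistence by one world.
    exact (forces_boxInst R _ _ A e (eval_numeral _ _)).2 h.sub_one

/-! ### The axioms and theorems of `S_□` -/

theorem forces_mainAxiom {R : Arithmetization} {S : Set Sentence} (hS : ∀ A ∈ S, A.IsArith)
    (hsound : IsSound S) {A : Sentence} (h : MainAxiom R S A) (w : ℕ) :
    Forces w A Fin.elim0 := by
  cases h with
  | theory A h => exact forces_of_isTrue (hS A h) (hsound A h) w
  | induction A => exact (forces_close _).2 (forces_inductionAxiom A w)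
  | logical A h => exact (forces_close _).2 (forces_logicalAxiom h w)
  | box A h => exact forces_boxAxiom h w

theorem Theorem.forces {Γ : Set Sentence} {A : Sentence} (h : Theorem Γ A) {w : ℕ}
    (hΓ : ∀ B ∈ Γ, Forces w B Fin.elim0) : Forces w A Fin.elim0 := by
  induction h with
  | ax A h => exact hΓ A h
  | mp A B _ _ hA hB =>
    rw [forces_close] at hA hB ⊢
    exact fun e => (forces_imp A B e).1 (hB e) _ le_rfl (hA e)

theorem forces_boxSystem {R : Arithmetization} {S : Set Sentence} {Ax : Fm 1}
    (hAx : Expresses Ax fun v => ∃ B : Sentence, MainAxiom R S B ∧ v 0 = B.gn)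
    (hS : ∀ A ∈ S, A.IsArith) (hsound : IsSound S) {A : Sentence}
    (h : A ∈ boxSystem R S Ax) (w : ℕ) : Forces w A Fin.elim0 := by
  obtain h | rfl := h
  · exact forces_mainAxiom hS hsound h w
  · refine (forces_all _ _).2 fun g => forces_imp_of_expresses hAx ?_ w
    rintro ⟨B, hB, h⟩ v
    -- The main axioms hold in all worlds, hence also at `v - 1`. There is no circularity: `Ax`
    -- covers the main axioms only, not the jump axiom.
    exact (forces_box (t := .var 0) h).2 (forces_mainAxiom hS hsound hB _)

/-- Each box descends one world. Starting at `k + 1` ends at `1`, the lowest world that does not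
force everything. -/
theorem forces_boxPow (k : ℕ) (A : Sentence) :
    Forces (k + 1) (boxPow k A) Fin.elim0 ↔ Forces 1 A Fin.elim0 := by
  induction k with
  | zero => rfl
  | succ k ih => exact (forces_box (eval_numeral _ _)).trans ih

end Assert

/-- `S` is a recursively axiomatized theory in the language of first order arithmetic extending
PA, and `Ax` is any formula of first order arithmetic which expresses that a number is the Gödel
number of a main axiom of `S_□`. -/
theorem theorem3p2 (S : Set Assert.Sentence) (hS : Assert.IsRecursiveExtensionOfPA S)
    (R : Assert.Arithmetization) (Ax : Assert.Fm 1)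
    (hAx : Assert.Expresses Ax fun v =>
      ∃ B : Assert.Sentence, Assert.MainAxiom R S B ∧ v 0 = B.gn)
    (hsound : Assert.IsSound S)
    (A : Assert.Sentence) (hA : A.IsArith) (hfalse : ¬ A.IsTrue) :
    ¬ Assert.Theorem (Assert.boxSystem R S Ax) A ∧
      ∀ k : ℕ, 1 ≤ k → ¬ Assert.Theorem (Assert.boxSystem R S Ax) (Assert.boxPow k A) := by
  -- The case `k = 0` is the claim about `A` itself. The world used is `k + 1`, fixed by unification
  -- with `forces_boxPow`.
  have key (k : ℕ) : ¬ Assert.Theorem (Assert.boxSystem R S Ax) (Assert.boxPow k A) := by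
    intro h
    have h1 := (Assert.forces_boxPow k A).1
      (h.forces fun B hB => Assert.forces_boxSystem hAx hS.arith hsound hB _)
    exact hfalse ((Assert.forces_succ_of_isArith hA 0 _).1 h1)
  exact ⟨key 0, fun k _ => key k⟩
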